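/- Let $K$ be a field of characteristic $0$. For a symmetric $4\times 4$ matrix $X$ let $\wedge_2 X$ be the symmetric $6\times 6$ matrix of its $2\times 2$ minors, with rows and columns labeled by $12,13,14,23,24,34$, and let $\wedge_3X$ be the symmetric $4\times 4$ matrix of its $3\times 3$ minors, with rows and columns labeled, with signs, by $234,-134,124,-123$. Let $\mathbb P^9,\mathbb P^{20},\mathbb P^9$ be the projective spaces of symmetric matrices of size $4,6,4$. The space of complete quadrics over $K$ is the Zariski closure, in the $K$-points of $\mathbb P^9\times\mathbb P^{20}\times\mathbb P^9$, of the image of the rational map $X\mapsto (X,\wedge_2X,\wedge_3X)$ on symmetric matrices over $K$. Let $\mathcal I_4\subset\mathbb Q[X,Y,Z]$ be the $\mathbb N^3$-homogeneous ideal (in $10+21+10=41$ unknowns) of all polynomials that vanish on the space of complete quadrics over $\mathbb C$ (that is, at all triples of nonzero matrices representing its points), and let $V(\mathcal I_4)$ be its set of zeros in $\mathbb P^9\times\mathbb P^{20}\times\mathbb P^9$ over $K$. The variety of complete flags in $\mathbb P^3$ over $K$ is the set of triples $(p,\ell,h)\in\mathbb P^3\times\mathbb P^5\times\mathbb P^3$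 such that there are a point $P$, a line $L$ and a plane $H$ in $\mathbb P^3$ with $P\subset L\subset H$, where $p$ represents $P$, $\ell=(\ell_{12},\ell_{13},\ell_{14},\ell_{23},\ell_{24},\ell_{34})$ is the vector of $2\times2$ minors of a $2\times 4$ matrix with row space $L$, and $h=(h_{234},-h_{134},h_{124},-h_{123})$ is the vector of signed $3\times3$ minors of a $3\times4$ matrix with row space $H$. Then the variety of complete flags in $\mathbb P^3$ is the inverse image of $V(\mathcal I_4)$ under the componentwise Veronese embedding $$\mathbb P^3\times\mathbb P^5\times\mathbb P^3\hookrightarrow\mathbb P^9\times\mathbb P^{20}\times\mathbb P^9,\qquad (p,\ell,h)\mapsto(p^Tp,\ \ell^T\ell,\ h^Th),$$ and likewise it is the inverse image of the space of complete quadrics over $K$. -/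

import Mathlib

open scoped LinearAlgebra.Projectivization

noncomputable section

namespace CompleteQuadrics

/-- The ordered pairs `12, 13, 14, 23, 24, 34` (shifted to start at `0`), which label the
coordinates of a line. -/
def pair : Fin 6 → Fin 2 → Fin 4 :=
  ![![0, 1], ![0, 2], ![0, 3], ![1, 2], ![1, 3], ![2, 3]]

section Flags

variable {K : Type*} [Field K]

/-- The vector of `2 × 2` minors `(ℓ₁₂, ℓ₁₃, ℓ₁₄, ℓ₂₃, ℓ₂₄, ℓ₃₄)` of a `2 × 4` matrix. -/
def lineMinors (A : Matrix (Fin 2) (Fin 4) K) : Fin 6 → K :=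
  fun a => (A.submatrix id (pair a)).det

/-- The vector of signed `3 × 3` minors `(h₂₃₄, -h₁₃₄, h₁₂₄, -h₁₂₃)` of a `3 × 4` matrix. -/
def planeMinors (A : Matrix (Fin 3) (Fin 4) K) : Fin 4 → K :=
  fun a => (-1) ^ (a : ℕ) * (A.submatrix id a.succAbove).det

/-- `ℓ ∈ ℙ⁵` is the vector of Plücker coordinates of the line `ℙ(L) ⊆ ℙ³`: the minors of a
`2 × 4` matrix of rank two with row space `L`. -/
def IsLineCoords (L : Submodule K (Fin 4 → K)) (l : ℙ K (Fin 6 → K)) : Prop :=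
  ∃ (A : Matrix (Fin 2) (Fin 4) K) (hA : lineMinors A ≠ 0),
    Submodule.span K (Set.range A.row) = L ∧ l = Projectivization.mk K (lineMinors A) hA

/-- `h ∈ ℙ³` is the vector of Plücker coordinates of the plane `ℙ(H) ⊆ ℙ³`: the signed minors
of a `3 × 4` matrix of rank three with row space `H`. -/
def IsPlaneCoords (H : Submodule K (Fin 4 → K)) (h : ℙ K (Fin 4 → K)) : Prop :=
  ∃ (A : Matrix (Fin 3) (Fin 4) K) (hA : planeMinors A ≠ 0),
    Submodule.span K (Set.range A.row) = H ∧ h = Projectivization.mk K (planeMinors A) hA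

variable (K) in
/-- The variety of complete flags `P ⊂ L ⊂ H` (point, line, plane) in `ℙ³`, in `ℙ³ × ℙ⁵ × ℙ³`
by Plücker coordinates. -/
def flagVariety : Set (ℙ K (Fin 4 → K) × ℙ K (Fin 6 → K) × ℙ K (Fin 4 → K)) :=
  {t | ∃ P L H : Submodule K (Fin 4 → K), P ≤ L ∧ L ≤ H ∧
    t.1.submodule = P ∧ IsLineCoords L t.2.1 ∧ IsPlaneCoords H t.2.2}

end Flags

section Sym

variable (n : ℕ) (K : Type*) [Field K]

/-- The space of symmetric `n × n` matrices. -/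
def SymMatrix : Submodule K (Matrix (Fin n) (Fin n) K) where
  carrier := {X | X.IsSymm}
  add_mem' hX hY := Matrix.IsSymm.add hX hY
  zero_mem' := Matrix.isSymm_zero
  smul_mem' c _ hX := Matrix.IsSymm.smul hX c

variable {n K}

/-- The rank one symmetric matrix `vᵀ v` of a row vector `v`. -/
def rankOne (v : Fin n → K) : SymMatrix n K :=
  ⟨Matrix.vecMulVec v v, Matrix.transpose_vecMulVec v v⟩

theorem rankOne_ne_zero {v : Fin n → K} (hv : v ≠ 0) : rankOne v ≠ 0 := fun h => by
  have h' : Matrix.vecMulVec v v = 0 := congrArg Subtype.val h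
  rcases Matrix.vecMulVec_eq_zero.1 h' with h0 | h0 <;> exact hv h0

theorem rankOne_smul (c : K) (v : Fin n → K) : rankOne (c • v) = (c * c) • rankOne v := by
  apply Subtype.ext
  ext i j
  simp [rankOne, Matrix.vecMulVec_apply]
  ring

/-- The Veronese embedding `[v] ↦ [vᵀ v]`. -/
def veronese : ℙ K (Fin n → K) → ℙ K (SymMatrix n K) :=
  Projectivization.lift (fun v => Projectivization.mk K (rankOne v.1) (rankOne_ne_zero v.2))
    (fun a b t h => by
      rw [Projectivization.mk_eq_mk_iff']
      exact ⟨t * t, by rw [h, rankOne_smul]⟩)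

/-- The `Sym2`-indexed coordinates (entries on or above the diagonal) of a symmetric matrix. -/
def entry (X : SymMatrix n K) : Sym2 (Fin n) → K :=
  Sym2.lift ⟨fun i j => X.1 i j, fun i j => (Matrix.IsSymm.apply X.2 i j).symm⟩

/-- The second exterior power of a symmetric `4 × 4` matrix: the matrix of its `2 × 2` minors,
rows and columns labelled by `pair`. -/
def wedge2 (X : SymMatrix 4 K) : SymMatrix 6 K :=
  ⟨Matrix.of fun a b => (X.1.submatrix (pair a) (pair b)).det, by
    ext a b
    have hX : X.1.transpose = X.1 := X.2
    rw [Matrix.transpose_apply, Matrix.of_apply, Matrix.of_apply, ← Matrix.det_transpose,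
      Matrix.transpose_submatrix, hX]⟩

/-- The third exterior power of a symmetric `4 × 4` matrix: the matrix of its `3 × 3` minors,
rows and columns labelled, with signs, as the coordinates `(h₂₃₄, -h₁₃₄, h₁₂₄, -h₁₂₃)`. -/
def wedge3 (X : SymMatrix 4 K) : SymMatrix 4 K :=
  ⟨Matrix.of fun a b => (-1) ^ (a : ℕ) * (-1) ^ (b : ℕ) *
      (X.1.submatrix a.succAbove b.succAbove).det, by
    ext a b
    have hX : X.1.transpose = X.1 := X.2
    rw [Matrix.transpose_apply, Matrix.of_apply, Matrix.of_apply, ← Matrix.det_transpose,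
      Matrix.transpose_submatrix, hX, mul_comm ((-1 : K) ^ (b : ℕ))]⟩

end Sym

/-- The `10 + 21 + 10 = 41` unknowns: the entries of `X`, `Y` and `Z`. -/
abbrev Var : Type := Sym2 (Fin 4) ⊕ Sym2 (Fin 6) ⊕ Sym2 (Fin 4)

section Space

variable (K : Type*) [Field K]

/-- The ambient space `ℙ⁹ × ℙ²⁰ × ℙ⁹`. -/
abbrev Ambient : Type _ := ℙ K (SymMatrix 4 K) × ℙ K (SymMatrix 6 K) × ℙ K (SymMatrix 4 K)

variable {K}

/-- The vectors of `41` coordinates of all triples `(X, Y, Z)` of nonzero symmetric matrices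
that represent a point of `S`. -/
def multicone (S : Set (Ambient K)) : Set (Var → K) :=
  {c | ∃ (X : SymMatrix 4 K) (Y : SymMatrix 6 K) (Z : SymMatrix 4 K)
      (hX : X ≠ 0) (hY : Y ≠ 0) (hZ : Z ≠ 0),
    (Projectivization.mk K X hX, Projectivization.mk K Y hY, Projectivization.mk K Z hZ) ∈ S ∧
    c = Sum.elim (entry X) (Sum.elim (entry Y) (entry Z))}

/-- The ideal of `S` in `k[X, Y, Z]`: the polynomials that vanish at all coordinate vectors of
points of `S`. As the three factors can be rescaled independently, over an infinite field it is
generated by the tri-homogeneous polynomials that vanish on `S`. -/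
def idealOf (k : Type*) [Field k] [Algebra k K] (S : Set (Ambient K)) :
    Ideal (MvPolynomial Var k) :=
  MvPolynomial.vanishingIdeal k (multicone S)

variable (K) in
/-- The zero set `V(I)` in `ℙ⁹ × ℙ²⁰ × ℙ⁹` over `K` of a (tri-homogeneous) ideal. -/
def projZeroLocus {k : Type*} [Field k] [Algebra k K] (I : Ideal (MvPolynomial Var k)) :
    Set (Ambient K) :=
  {t | multicone {t} ⊆ MvPolynomial.zeroLocus K I}

/-- The Zariski closure of a subset of `ℙ⁹ × ℙ²⁰ × ℙ⁹` over `K`. -/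
def zariskiClosure (S : Set (Ambient K)) : Set (Ambient K) :=
  projZeroLocus K (idealOf K S)

variable (K)

/-- The image of the rational map `X ↦ (X, ∧₂ X, ∧₃ X)`. -/
def quadricImage : Set (Ambient K) :=
  {t | ∃ (X : SymMatrix 4 K) (h1 : X ≠ 0) (h2 : wedge2 X ≠ 0) (h3 : wedge3 X ≠ 0),
    t = (Projectivization.mk K X h1, Projectivization.mk K (wedge2 X) h2,
      Projectivization.mk K (wedge3 X) h3)}

/-- The space of complete quadrics over `K`. -/
def completeQuadrics : Set (Ambient K) :=
  zariskiClosure (quadricImage K)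

/-- The ideal `I₄ ⊆ ℚ[X, Y, Z]` of the space of complete quadrics (over the complex numbers). -/
def idealI4 : Ideal (MvPolynomial Var ℚ) :=
  idealOf ℚ (completeQuadrics ℂ)

/-- The componentwise Veronese embedding `ℙ³ × ℙ⁵ × ℙ³ → ℙ⁹ × ℙ²⁰ × ℙ⁹`,
`(p, ℓ, h) ↦ (pᵀ p, ℓᵀ ℓ, hᵀ h)`. -/
def veroneseTriple :
    ℙ K (Fin 4 → K) × ℙ K (Fin 6 → K) × ℙ K (Fin 4 → K) → Ambient K :=
  fun t => (veronese t.1, veronese t.2.1, veronese t.2.2)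

end Space

end CompleteQuadrics

end

/-!
The ideal `I₄` is the ideal over `ℚ` of the image of `X ↦ (X, ∧₂ X, ∧₃ X)` over `ℂ`, because taking
the Zariski closure does not change it (`CompleteQuadrics.idealOf_zariskiClosure`). So both
assertions are cases of `CompleteQuadrics.flagVariety_eq_preimage`: for an infinite field `k` with
extensions `F` and `K`, where `K` has characteristic zero, the flag variety over `K` is the preimage
of the zero set over `K` of the ideal over `k` of the image over `F`. The cases are
`(k, F, K) = (ℚ, ℂ, K)` and `(K, K, K)`.

Flags satisfy the equations by a degeneration. Write a flag by the leading rows of a `3 × 4` matrix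
`A` and put `X_t = Aᵀ diag(1, t, t²) A`. By the Cauchy–Binet formula `(X_t, t⁻¹ ∧₂ X_t, t⁻³ ∧₃ X_t)`
is polynomial in `t` and in the entries of `A`, and at `t = 0` it is the triple of rank one matrices
of the flag. A polynomial over `k` that vanishes on the image over `F` pulls back to a polynomial in
`A`, `t` and three scaling factors that vanishes at all `k`-points outside a hypersurface, hence is
zero, and so it vanishes at all `K`-points, those with `t = 0` included
(`CompleteQuadrics.aeval_family_eq_zero`).

Conversely, three kinds of relations with coefficients `±1` hold on the image. They are the linear
relation `Y₁₂,₃₄ - Y₁₃,₂₄ + Y₁₄,₂₃ = 0`, the relations `X_r ∧ Y_{qs} + X_q ∧ Y_{rs} = 0`, which hold as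
the rows of `∧₂ X` are `X_q ∧ X_s`, and those entries of the contraction of `Y` with `Z` that vanish
or agree because `X` times its adjugate `∧₃ X` is a scalar matrix. On a triple of rank one matrices
they say that `ℓ` satisfies the Plücker relation, that `p` lies on `ℓ`, and that `ℓ` lies in `h`
(`CompleteQuadrics.mem_flagVariety_of_relations`), and these equations cut out the flags
(`CompleteQuadrics.mem_flagVariety_of_equations`).
-/

open scoped LinearAlgebra.Projectivization

namespace CompleteQuadrics

open Matrix

/-- The alternating `4 × 4` matrix whose entries above the diagonal are the six line
coordinates `l`; the other entries extend the coordinates alternatingly to all index pairs. -/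
def lineMatrix {R : Type*} [CommRing R] (l : Fin 6 → R) : Matrix (Fin 4) (Fin 4) R :=
  !![0, l 0, l 1, l 2; -l 0, 0, l 3, l 4; -l 1, -l 3, 0, l 5; -l 2, -l 4, -l 5, 0]

/-! ### Line coordinates as alternating matrices -/

section LineMatrix

variable {R S : Type*} [CommRing R] [CommRing S]

theorem lineMatrix_pair (l : Fin 6 → R) (a : Fin 6) :
    lineMatrix l (pair a 0) (pair a 1) = l a := by
  fin_cases a <;> rfl

theorem lineMatrix_of_alternating {g : Fin 4 → Fin 4 → R} (h0 : ∀ i, g i i = 0)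
    (h1 : ∀ i j, g i j = -g j i) (i j : Fin 4) :
    lineMatrix (fun a => g (pair a 0) (pair a 1)) i j = g i j := by
  fin_cases i <;> fin_cases j <;> simp [lineMatrix, pair, h0] <;> rw [h1, neg_neg]

theorem lineMatrix_mul_left (c : R) (l : Fin 6 → R) (i j : Fin 4) :
    lineMatrix (fun a => c * l a) i j = c * lineMatrix l i j := by
  fin_cases i <;> fin_cases j <;> simp [lineMatrix]

theorem map_lineMatrix (φ : R →+* S) (l : Fin 6 → R) (i j : Fin 4) :
    φ (lineMatrix l i j) = lineMatrix (fun a => φ (l a)) i j := by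
  fin_cases i <;> fin_cases j <;> simp [lineMatrix]

/-- Under the Plücker relation, the `2 × 2` minors of rows `r` and `s` of the alternating matrix of
`l` are `l` itself, scaled by the `(r, s)` entry. -/
theorem lineMatrix_plucker {l : Fin 6 → R} (h : l 0 * l 5 - l 1 * l 4 + l 2 * l 3 = 0)
    (r s i j : Fin 4) :
    lineMatrix l r i * lineMatrix l s j - lineMatrix l r j * lineMatrix l s i =
      lineMatrix l r s * lineMatrix l i j := by
  fin_cases r <;> fin_cases s <;> fin_cases i <;> fin_cases j <;> simp [lineMatrix] <;>
    first
    | done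
    | ring1
    | linear_combination h
    | linear_combination -h

end LineMatrix

/-! ### Flags in coordinates -/

section Incidence

variable {K : Type*} [Field K]

/-- The Plücker relation makes `l` decomposable: two rows of the alternating matrix of `l` span
the line with coordinates `l`. The second condition says `p ∧ l = 0`, and the third that `h`
annihilates the line, where `h` is read as a linear form with kernel the plane. -/
theorem mem_flagVariety_of_equations {p : Fin 4 → K} {l : Fin 6 → K} {h : Fin 4 → K}
    (hp : p ≠ 0) (hl : l ≠ 0) (hh : h ≠ 0)
    (hplucker : l 0 * l 5 - l 1 * l 4 + l 2 * l 3 = 0)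
    (hpl : ∀ i j k, p i * lineMatrix l j k - p j * lineMatrix l i k + p k * lineMatrix l i j = 0)
    (hlh : ∀ i, ∑ j, lineMatrix l i j * h j = 0) :
    (Projectivization.mk K p hp, Projectivization.mk K l hl, Projectivization.mk K h hh) ∈
      flagVariety K := by
  obtain ⟨a, ha⟩ := Function.ne_iff.1 hl
  obtain ⟨q, hq⟩ := Function.ne_iff.1 hh
  rw [Pi.zero_apply] at ha hq
  obtain ⟨r, s, hrs⟩ : ∃ r s, lineMatrix l r s ≠ 0 :=
    ⟨pair a 0, pair a 1, by rwa [lineMatrix_pair]⟩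
  set A : Matrix (Fin 2) (Fin 4) K := Matrix.of ![lineMatrix l r, lineMatrix l s] with hAdef
  -- The rows of `B` are the vectors `h_q e_i - h_i e_q` for `i ≠ q`, which span the kernel of `h`.
  set B : Matrix (Fin 3) (Fin 4) K := Matrix.of fun b i =>
    Pi.single (M := fun _ => K) (q.succAbove b) (h q) i
      - Pi.single (M := fun _ => K) q (h (q.succAbove b)) i with hBdef
  have hA : lineMinors A = lineMatrix l r s • l := by
    ext b
    rw [lineMinors, det_fin_two]
    simp only [hAdef, submatrix_apply, id, of_apply, Pi.smul_apply, smul_eq_mul, cons_val_zero,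
      cons_val_one]
    rw [← lineMatrix_pair l b]
    exact lineMatrix_plucker hplucker r s (pair b 0) (pair b 1)
  have hA0 : lineMinors A ≠ 0 := hA ▸ smul_ne_zero hrs hl
  have hB : planeMinors B = ((-1) ^ (q : ℕ) * h q ^ 2) • h := by
    ext b
    rw [planeMinors, det_fin_three]
    fin_cases q <;> fin_cases b <;>
      simp [hBdef, Fin.succAbove, Pi.single_apply, -mul_eq_mul_right_iff] <;> ring1
  have hB0 : planeMinors B ≠ 0 :=
    hB ▸ smul_ne_zero (mul_ne_zero (pow_ne_zero _ (by simp)) (pow_ne_zero _ hq)) hh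
  refine ⟨K ∙ p, Submodule.span K (Set.range A.row), Submodule.span K (Set.range B.row), ?_, ?_,
    Projectivization.submodule_mk _ _, ⟨A, hA0, rfl, ?_⟩, ⟨B, hB0, rfl, ?_⟩⟩
  · rw [Submodule.span_singleton_le_iff_mem]
    have h2 : p = ((lineMatrix l r s)⁻¹ * p s) • A.row 0 -
        ((lineMatrix l r s)⁻¹ * p r) • A.row 1 := by
      ext k
      simp only [hAdef, row, of_apply, Pi.smul_apply, Pi.sub_apply, smul_eq_mul, cons_val_zero,
        cons_val_one]
      field_simp
      linear_combination hpl r s k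
    rw [h2]
    exact sub_mem (Submodule.smul_mem _ _ (Submodule.subset_span ⟨0, rfl⟩))
      (Submodule.smul_mem _ _ (Submodule.subset_span ⟨1, rfl⟩))
  · -- A vector annihilated by `h` is a combination of the rows of `B`.
    have key : ∀ u : Fin 4 → K, ∑ j, u j * h j = 0 → u ∈ Submodule.span K (Set.range B.row) := by
      intro u hu
      have h2 : u = ∑ b, (u (q.succAbove b) / h q) • B.row b := by
        rw [Fin.sum_univ_four] at hu
        ext k
        simp only [hBdef, row, Fin.sum_univ_three, Pi.add_apply, Pi.smul_apply, of_apply,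
          smul_eq_mul]
        fin_cases q <;> fin_cases k <;> simp [Fin.succAbove] <;>
          simp at hq <;> field_simp <;> linear_combination hu
      rw [h2]
      exact sum_mem fun b _ => Submodule.smul_mem _ _ (Submodule.subset_span ⟨b, rfl⟩)
    rw [Submodule.span_le]
    rintro _ ⟨b, rfl⟩
    fin_cases b
    exacts [key _ (hlh r), key _ (hlh s)]
  · exact (Projectivization.mk_eq_mk_iff' ..).2 ⟨(lineMatrix l r s)⁻¹, by
      rw [hA, smul_smul, inv_mul_cancel₀ hrs, one_smul]⟩
  · refine (Projectivization.mk_eq_mk_iff' ..).2 ⟨((-1) ^ (q : ℕ) * h q ^ 2)⁻¹, ?_⟩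
    rw [hB, smul_smul, inv_mul_cancel₀ (mul_ne_zero (pow_ne_zero _ (by simp)) (pow_ne_zero _ hq)),
      one_smul]

theorem lineMinors_eq (A : Matrix (Fin 2) (Fin 4) K) (a : Fin 6) :
    lineMinors A a = A 0 (pair a 0) * A 1 (pair a 1) - A 0 (pair a 1) * A 1 (pair a 0) := by
  rw [lineMinors, det_fin_two]; rfl

theorem lineMinors_mul (G : Matrix (Fin 2) (Fin 2) K) (A : Matrix (Fin 2) (Fin 4) K) :
    lineMinors (G * A) = G.det • lineMinors A := by
  ext a
  rw [lineMinors, ← submatrix_mul_equiv G A id (Equiv.refl _) (pair a), det_mul]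
  rfl

theorem planeMinors_mul (G : Matrix (Fin 3) (Fin 3) K) (A : Matrix (Fin 3) (Fin 4) K) :
    planeMinors (G * A) = G.det • planeMinors A := by
  ext a
  rw [planeMinors, ← submatrix_mul_equiv G A id (Equiv.refl _) a.succAbove, det_mul,
    mul_left_comm]
  rfl

/-- A nonzero vector of length two is the first row of an invertible matrix. -/
theorem exists_det_ne_zero_of_row {x : Fin 2 → K} (hx : x ≠ 0) :
    ∃ y : Fin 2 → K, (Matrix.of ![x, y]).det ≠ 0 := by
  by_contra! H
  have h0 := H ![0, 1]
  have h1 := H ![1, 0]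
  rw [det_fin_two] at h0 h1
  simp at h0 h1
  exact hx (by ext i; fin_cases i <;> assumption)

/-- If `C` has rank two, which is forced by the nonvanishing minors of `C * B`, then its rows
extend to an invertible matrix: otherwise the cross product of the two rows would be zero. -/
theorem exists_det_ne_zero_of_two_rows {C : Matrix (Fin 2) (Fin 3) K}
    {B : Matrix (Fin 3) (Fin 4) K} (h : lineMinors (C * B) ≠ 0) :
    ∃ y : Fin 3 → K, (Matrix.of ![C 0, C 1, y]).det ≠ 0 := by
  by_contra! H
  have h0 := H ![1, 0, 0]
  have h1 := H ![0, 1, 0]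
  have h2 := H ![0, 0, 1]
  rw [det_fin_three] at h0 h1 h2
  simp at h0 h1 h2
  apply h
  ext a
  simp only [lineMinors_eq, mul_apply, Fin.sum_univ_three, Pi.zero_apply]
  generalize pair a 0 = i
  generalize pair a 1 = j
  linear_combination (B 1 i * B 2 j - B 1 j * B 2 i) * h0 +
    (B 2 i * B 0 j - B 2 j * B 0 i) * h1 + (B 0 i * B 1 j - B 0 j * B 1 i) * h2

/-- A flag is the flag of the leading rows of one `3 × 4` matrix `M`. -/
theorem exists_adapted_matrix {t : ℙ K (Fin 4 → K) × ℙ K (Fin 6 → K) × ℙ K (Fin 4 → K)}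
    (ht : t ∈ flagVariety K) :
    ∃ (M : Matrix (Fin 3) (Fin 4) K) (h1 : M 0 ≠ 0)
      (h2 : lineMinors (Matrix.of ![M 0, M 1]) ≠ 0) (h3 : planeMinors M ≠ 0),
      t = (Projectivization.mk K (M 0) h1, Projectivization.mk K _ h2,
        Projectivization.mk K _ h3) := by
  -- With `p = x A` and `A = C B`, first complete `x` to an invertible `G`, then the two rows of
  -- `G C` to an invertible `D`; the matrix sought is `D B`.
  obtain ⟨P, L, H, hPL, hLH, hP, ⟨A, hA, rfl, hl⟩, ⟨B, hB, rfl, hh⟩⟩ := ht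
  obtain ⟨p, l, h⟩ := t
  dsimp only at hP hl hh
  subst hl hh hP
  induction p using Projectivization.ind with
  | h p hp =>
  have hpA : p ∈ Submodule.span K (Set.range A.row) :=
    hPL (by rw [Projectivization.submodule_mk]; exact Submodule.mem_span_singleton_self p)
  rw [Submodule.mem_span_range_iff_exists_fun] at hpA
  obtain ⟨x, hx⟩ := hpA
  have hx0 : x ≠ 0 := by
    rintro rfl
    exact hp (by rw [← hx]; simp)
  obtain ⟨y, hy⟩ := exists_det_ne_zero_of_row hx0
  have hAB : ∀ i, ∃ c : Fin 3 → K, ∑ b, c b • B.row b = A.row i := fun i =>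
    (Submodule.mem_span_range_iff_exists_fun K).1 (hLH (Submodule.subset_span ⟨i, rfl⟩))
  choose C hC using hAB
  have hCB : A = Matrix.of C * B := by
    ext i j
    rw [mul_apply]
    simpa using (congrFun (hC i) j).symm
  set G : Matrix (Fin 2) (Fin 2) K := Matrix.of ![x, y] with hG
  have hGA : lineMinors (G * A) ≠ 0 := by
    rw [lineMinors_mul]
    exact smul_ne_zero hy hA
  obtain ⟨z, hz⟩ := exists_det_ne_zero_of_two_rows (C := G * Matrix.of C) (B := B)
    (by rwa [Matrix.mul_assoc, ← hCB])
  set D : Matrix (Fin 3) (Fin 3) K :=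
    Matrix.of ![(G * Matrix.of C) 0, (G * Matrix.of C) 1, z] with hD
  have hM0 : (D * B) 0 = (G * A) 0 := by
    rw [hCB, ← Matrix.mul_assoc]; rfl
  have hM1 : (D * B) 1 = (G * A) 1 := by
    rw [hCB, ← Matrix.mul_assoc]; rfl
  have hp' : (G * A) 0 = p := by
    rw [← hx]
    ext j
    simp [mul_apply, hG]
  have hM2 : Matrix.of ![(D * B) 0, (D * B) 1] = G * A := by
    rw [hM0, hM1]
    ext i j
    fin_cases i <;> rfl
  have hDB : planeMinors (D * B) ≠ 0 := by
    rw [planeMinors_mul]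
    exact smul_ne_zero hz hB
  refine ⟨D * B, by rwa [hM0, hp'], by rwa [hM2], hDB, ?_⟩
  refine Prod.ext ?_ (Prod.ext ?_ ?_) <;> refine (Projectivization.mk_eq_mk_iff' ..).2 ?_
  · exact ⟨1, by rw [hM0, hp', one_smul]⟩
  · exact ⟨G.det⁻¹, by rw [hM2, lineMinors_mul, inv_smul_smul₀ hy]⟩
  · exact ⟨D.det⁻¹, by rw [planeMinors_mul, inv_smul_smul₀ hz]⟩

end Incidence

/-! ### Relations satisfied by complete quadrics -/

section Relations

variable {R S : Type*} [CommRing R] [CommRing S]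

/-- The `(i, j)` entry of the first matrix in a system of values `c` of the `41` unknowns. -/
def valX (c : Var → R) (i j : Fin 4) : R := c (Sum.inl s(i, j))

/-- The `(a, b)` entry of the second matrix in a system of values `c` of the `41` unknowns. -/
def valY (c : Var → R) (a b : Fin 6) : R := c (Sum.inr (Sum.inl s(a, b)))

/-- The `(i, j)` entry of the third matrix in a system of values `c` of the `41` unknowns. -/
def valZ (c : Var → R) (i j : Fin 4) : R := c (Sum.inr (Sum.inr s(i, j)))

/-- The second matrix as a tensor with four indices in `Fin 4`, alternating in `r, s` and in
`i, j`: the entry in row `rs` and column `ij`, for arbitrary pairs. -/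
def tensorY (c : Var → R) (r s i j : Fin 4) : R :=
  lineMatrix (fun a => lineMatrix (valY c a) i j) r s

/-- The linear relation between the entries of `Y = ∧₂ X` that on rank one matrices `Y = ℓᵀ ℓ`
becomes the Plücker relation for `ℓ`. -/
def pluckerRel (c : Var → R) : R := valY c 0 5 - valY c 1 4 + valY c 2 3

/-- The `ijk` coordinate of `X_r ∧ Y_{qs} + X_q ∧ Y_{rs}`. As `Y_{qs} = X_q ∧ X_s` for
`Y = ∧₂ X`, this vanishes on complete quadrics. -/
def pointLineRel (c : Var → R) (r q s i j k : Fin 4) : R :=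
  valX c r i * tensorY c q s j k - valX c r j * tensorY c q s i k + valX c r k * tensorY c q s i j +
    (valX c q i * tensorY c r s j k - valX c q j * tensorY c r s i k +
      valX c q k * tensorY c r s i j)

/-- The contraction `∑ j, Y_{rs, ij} Z_{qj}`. As `∧₃ X` is the adjugate of `X`, it equals
`det X * (X_{ri} δ_{sq} - X_{si} δ_{rq})` for `Y = ∧₂ X` and `Z = ∧₃ X`. -/
def linePlaneSum (c : Var → R) (r s q i : Fin 4) : R :=
  ∑ j, tensorY c r s i j * valZ c q j

theorem map_tensorY (φ : R →+* S) (c : Var → R) (r s i j : Fin 4) :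
    φ (tensorY c r s i j) = tensorY (fun v => φ (c v)) r s i j := by
  simp only [tensorY, map_lineMatrix]
  rfl

theorem map_pluckerRel (φ : R →+* S) (c : Var → R) :
    φ (pluckerRel c) = pluckerRel (fun v => φ (c v)) := by
  simp [pluckerRel, valY]

theorem map_pointLineRel (φ : R →+* S) (c : Var → R) (r q s i j k : Fin 4) :
    φ (pointLineRel c r q s i j k) = pointLineRel (fun v => φ (c v)) r q s i j k := by
  simp [pointLineRel, map_tensorY, valX]

theorem map_linePlaneSum (φ : R →+* S) (c : Var → R) (r s q i : Fin 4) :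
    φ (linePlaneSum c r s q i) = linePlaneSum (fun v => φ (c v)) r s q i := by
  simp [linePlaneSum, map_tensorY, valZ]

end Relations

section Coordinates

variable {K : Type*} [Field K]

/-- The `41` coordinates of a triple of symmetric matrices. -/
def coords (X : SymMatrix 4 K) (Y : SymMatrix 6 K) (Z : SymMatrix 4 K) : Var → K :=
  Sum.elim (entry X) (Sum.elim (entry Y) (entry Z))

@[simp] theorem valX_coords (X : SymMatrix 4 K) (Y : SymMatrix 6 K) (Z : SymMatrix 4 K)
    (i j : Fin 4) : valX (coords X Y Z) i j = X.1 i j := rfl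

@[simp] theorem valY_coords (X : SymMatrix 4 K) (Y : SymMatrix 6 K) (Z : SymMatrix 4 K)
    (a b : Fin 6) : valY (coords X Y Z) a b = Y.1 a b := rfl

@[simp] theorem valZ_coords (X : SymMatrix 4 K) (Y : SymMatrix 6 K) (Z : SymMatrix 4 K)
    (i j : Fin 4) : valZ (coords X Y Z) i j = Z.1 i j := rfl

theorem rankOne_apply {n : ℕ} (v : Fin n → K) (i j : Fin n) : (rankOne v).1 i j = v i * v j := rfl

theorem wedge2_apply (X : SymMatrix 4 K) (a b : Fin 6) :
    (wedge2 X).1 a b = X.1 (pair a 0) (pair b 0) * X.1 (pair a 1) (pair b 1) -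
      X.1 (pair a 0) (pair b 1) * X.1 (pair a 1) (pair b 0) :=
  det_fin_two _

theorem wedge3_eq_adjugate (X : SymMatrix 4 K) (i j : Fin 4) :
    (wedge3 X).1 i j = X.1.adjugate j i := by
  rw [adjugate_fin_succ_eq_det_submatrix, pow_add]
  rfl

theorem exists_coords_of_mem_multicone {c : Var → K} (hc : c ∈ multicone (quadricImage K)) :
    ∃ (X : SymMatrix 4 K) (α β γ : K), c = coords (α • X) (β • wedge2 X) (γ • wedge3 X) := by
  obtain ⟨X', Y', Z', hX, hY, hZ, ⟨X, h1, h2, h3, h⟩, rfl⟩ := hc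
  simp only [Prod.mk.injEq, Projectivization.mk_eq_mk_iff'] at h
  obtain ⟨⟨α, hα⟩, ⟨β, hβ⟩, ⟨γ, hγ⟩⟩ := h
  exact ⟨X, α, β, γ, by rw [hα, hβ, hγ, coords]⟩

variable (X : SymMatrix 4 K) (α β γ : K)

theorem tensorY_wedge2 (Y Z : SymMatrix 4 K) (r s i j : Fin 4) :
    tensorY (coords Y (β • wedge2 X) Z) r s i j =
      β * (X.1 r i * X.1 s j - X.1 r j * X.1 s i) := by
  have h : ∀ a b, valY (coords Y (β • wedge2 X) Z) a b =
      β * (X.1 (pair a 0) (pair b 0) * X.1 (pair a 1) (pair b 1) -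
        X.1 (pair a 0) (pair b 1) * X.1 (pair a 1) (pair b 0)) := by
    intro a b
    exact congrArg (β * ·) (wedge2_apply X a b)
  have h' : ∀ a, valY (coords Y (β • wedge2 X) Z) a = fun b =>
      β * (X.1 (pair a 0) (pair b 0) * X.1 (pair a 1) (pair b 1) -
        X.1 (pair a 0) (pair b 1) * X.1 (pair a 1) (pair b 0)) := fun a => funext (h a)
  simp only [tensorY, h']
  rw [show (fun a => lineMatrix (fun b =>
        β * (X.1 (pair a 0) (pair b 0) * X.1 (pair a 1) (pair b 1) -
          X.1 (pair a 0) (pair b 1) * X.1 (pair a 1) (pair b 0))) i j) =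
      fun a => β * (X.1 (pair a 0) i * X.1 (pair a 1) j - X.1 (pair a 0) j * X.1 (pair a 1) i) from
    funext fun a => lineMatrix_of_alternating
      (g := fun i j =>
        β * (X.1 (pair a 0) i * X.1 (pair a 1) j - X.1 (pair a 0) j * X.1 (pair a 1) i))
      (fun i => by ring) (fun i j => by ring) i j]
  exact lineMatrix_of_alternating
    (g := fun r s => β * (X.1 r i * X.1 s j - X.1 r j * X.1 s i))
    (fun i => by ring) (fun i j => by ring) r s

theorem pluckerRel_wedge2 (Y Z : SymMatrix 4 K) :
    pluckerRel (coords Y (β • wedge2 X) Z) = 0 := by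
  have hs : ∀ i j, X.1 i j = X.1 j i := fun i j => X.2.apply j i
  simp only [pluckerRel, valY_coords, Submodule.coe_smul, Matrix.smul_apply, smul_eq_mul,
    wedge2_apply]
  simp only [pair, cons_val]
  rw [hs 2 1, hs 3 1, hs 3 2]
  ring

theorem pointLineRel_wedge2 (Z : SymMatrix 4 K) (r q s i j k : Fin 4) :
    pointLineRel (coords (α • X) (β • wedge2 X) Z) r q s i j k = 0 := by
  simp only [pointLineRel, tensorY_wedge2, valX_coords, Submodule.coe_smul, Matrix.smul_apply,
    smul_eq_mul]
  ring

theorem linePlaneSum_wedge (Y : SymMatrix 4 K) (r s q i : Fin 4) :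
    linePlaneSum (coords Y (β • wedge2 X) (γ • wedge3 X)) r s q i =
      β * γ * X.1.det * (X.1 r i * (1 : Matrix (Fin 4) (Fin 4) K) s q -
        X.1 s i * (1 : Matrix (Fin 4) (Fin 4) K) r q) := by
  have h : ∀ s, ∑ j, X.1 s j * X.1.adjugate j q = X.1.det * (1 : Matrix (Fin 4) (Fin 4) K) s q := by
    intro s
    rw [← mul_apply, mul_adjugate, Matrix.smul_apply, smul_eq_mul]
  simp only [linePlaneSum, tensorY_wedge2, valZ_coords, Submodule.coe_smul, Matrix.smul_apply,
    smul_eq_mul, wedge3_eq_adjugate]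
  have h1 := h s
  have h2 := h r
  rw [Fin.sum_univ_four] at *
  linear_combination β * γ * X.1 r i * h1 - β * γ * X.1 s i * h2

end Coordinates

/-! ### From the relations to flags -/

section Vanishing

variable {k F K : Type*} [Field k] [Field F] [Field K] [Algebra k F] [Algebra k K]

theorem pluckerRel_mem : pluckerRel MvPolynomial.X ∈ idealOf k (quadricImage F) := by
  refine MvPolynomial.mem_vanishingIdeal_iff.2 fun c hc => ?_
  obtain ⟨X, α, β, γ, rfl⟩ := exists_coords_of_mem_multicone hc
  refine (map_pluckerRel (MvPolynomial.aeval _ : _ →ₐ[k] F).toRingHom _).trans ?_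
  simpa using pluckerRel_wedge2 X β _ _

theorem pointLineRel_mem (r q s i j l : Fin 4) :
    pointLineRel MvPolynomial.X r q s i j l ∈ idealOf k (quadricImage F) := by
  refine MvPolynomial.mem_vanishingIdeal_iff.2 fun c hc => ?_
  obtain ⟨X, α, β, γ, rfl⟩ := exists_coords_of_mem_multicone hc
  refine (map_pointLineRel (MvPolynomial.aeval _ : _ →ₐ[k] F).toRingHom _ ..).trans ?_
  simpa using pointLineRel_wedge2 X α β _ r q s i j l

theorem linePlaneSum_mem {r s q : Fin 4} (hr : q ≠ r) (hs : q ≠ s) (i : Fin 4) :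
    linePlaneSum MvPolynomial.X r s q i ∈ idealOf k (quadricImage F) := by
  refine MvPolynomial.mem_vanishingIdeal_iff.2 fun c hc => ?_
  obtain ⟨X, α, β, γ, rfl⟩ := exists_coords_of_mem_multicone hc
  refine (map_linePlaneSum (MvPolynomial.aeval _ : _ →ₐ[k] F).toRingHom _ ..).trans ?_
  simpa [one_apply_ne hr.symm, one_apply_ne hs.symm] using linePlaneSum_wedge X β γ (α • X) r s q i

theorem linePlaneSum_sub_mem {r s s' : Fin 4} (hs : r ≠ s) (hs' : r ≠ s') (i : Fin 4) :
    linePlaneSum MvPolynomial.X r s s i - linePlaneSum MvPolynomial.X r s' s' i ∈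
      idealOf k (quadricImage F) := by
  refine MvPolynomial.mem_vanishingIdeal_iff.2 fun c hc => ?_
  obtain ⟨X, α, β, γ, rfl⟩ := exists_coords_of_mem_multicone hc
  have h := fun s => map_linePlaneSum (MvPolynomial.aeval (coords (α • X) (β • wedge2 X)
    (γ • wedge3 X)) : _ →ₐ[k] F).toRingHom MvPolynomial.X r s s i
  simp only [AlgHom.toRingHom_eq_coe, RingHom.coe_coe, MvPolynomial.aeval_X] at h
  rw [map_sub, h, h, linePlaneSum_wedge, linePlaneSum_wedge]
  simp [one_apply_ne hs, one_apply_ne hs']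

/-- On rank one matrices the relations between `X`, `∧₂ X` and `∧₃ X` become the equations of the
flag variety, each multiplied by expressions in the coordinates of `p`, `l`, `h` that cannot all
vanish. -/
theorem mem_flagVariety_of_relations [CharZero K] {p : Fin 4 → K} {l : Fin 6 → K} {h : Fin 4 → K}
    (hp : p ≠ 0) (hl : l ≠ 0) (hh : h ≠ 0)
    (h1 : pluckerRel (coords (rankOne p) (rankOne l) (rankOne h)) = 0)
    (h2 : ∀ r q s i j k, pointLineRel (coords (rankOne p) (rankOne l) (rankOne h)) r q s i j k = 0)
    (h3 : ∀ r s q i, q ≠ r → q ≠ s →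
      linePlaneSum (coords (rankOne p) (rankOne l) (rankOne h)) r s q i = 0)
    (h4 : ∀ r s s' i, r ≠ s → r ≠ s' →
      linePlaneSum (coords (rankOne p) (rankOne l) (rankOne h)) r s s i =
        linePlaneSum (coords (rankOne p) (rankOne l) (rankOne h)) r s' s' i) :
    (Projectivization.mk K p hp, Projectivization.mk K l hl, Projectivization.mk K h hh) ∈
      flagVariety K := by
  have hY : ∀ r s i j, tensorY (coords (rankOne p) (rankOne l) (rankOne h)) r s i j =
      lineMatrix l r s * lineMatrix l i j := by
    intro r s i j
    have h' : ∀ a, valY (coords (rankOne p) (rankOne l) (rankOne h)) a = fun b => l a * l b :=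
      fun a => rfl
    simp only [tensorY, h', lineMatrix_mul_left]
    rw [mul_comm, ← lineMatrix_mul_left]
    simp only [mul_comm]
  have hW : ∀ r s q i, linePlaneSum (coords (rankOne p) (rankOne l) (rankOne h)) r s q i =
      lineMatrix l r s * h q * ∑ j, lineMatrix l i j * h j := by
    intro r s q i
    simp only [linePlaneSum, hY, valZ_coords, rankOne_apply, Finset.mul_sum]
    exact Finset.sum_congr rfl fun j _ => by ring
  have hl0 : ¬ ∀ r s, lineMatrix l r s = 0 := fun H =>
    hl (funext fun a => by rw [← lineMatrix_pair l a, H]; rfl)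
  have hanti : ∀ r s, lineMatrix l r s = -lineMatrix l s r := by
    intro r s
    fin_cases r <;> fin_cases s <;> simp [lineMatrix]
  refine mem_flagVariety_of_equations hp hl hh ?_ ?_ ?_
  · exact h1
  · intro i j k
    by_contra hne
    have h2' : ∀ r q s, p r * lineMatrix l q s + p q * lineMatrix l r s = 0 := by
      intro r q s
      have := h2 r q s i j k
      simp only [pointLineRel, hY, valX_coords, rankOne_apply] at this
      refine (mul_eq_zero.1 ?_).resolve_right hne
      linear_combination this
    -- Fix `p_r ≠ 0`. The case `q = r` says `2 p_r l_{rs} = 0`, and then `p_r l_{qs} = 0` for all `q`.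
    obtain ⟨r, hr⟩ := Function.ne_iff.1 hp
    rw [Pi.zero_apply] at hr
    have hrs : ∀ s, lineMatrix l r s = 0 := fun s => by
      have := h2' r r s
      rw [← two_mul] at this
      simpa [hr] using this
    exact hl0 fun q s => by simpa [hr, hrs] using h2' r q s
  · intro i
    by_contra hne
    -- Fix `h_q ≠ 0`. Then `l_{rs} h_q = 0` for `r, s ≠ q`, and `l_{rq} h_q = l_{rs} h_s = 0`.
    obtain ⟨q, hq⟩ := Function.ne_iff.1 hh
    rw [Pi.zero_apply] at hq
    have h3' : ∀ r s, q ≠ r → q ≠ s → lineMatrix l r s = 0 := by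
      intro r s hr hs
      have := h3 r s q i hr hs
      rw [hW] at this
      simpa [hne, hq] using this
    have hrq : ∀ r, r ≠ q → lineMatrix l r q = 0 := by
      intro r hr
      obtain ⟨s, hs, hs'⟩ : ∃ s : Fin 4, s ≠ r ∧ s ≠ q := by
        have : ∀ r q : Fin 4, ∃ s, s ≠ r ∧ s ≠ q := by decide
        exact this r q
      have := h4 r q s i hr hs.symm
      rw [hW, hW, h3' r s hr.symm hs'.symm] at this
      simpa [hne, hq] using this
    apply hl0
    intro r s
    by_cases hr : r = q
    · by_cases hs : s = q
      · rw [hr, hs]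
        fin_cases q <;> rfl
      · rw [hanti, hr, hrq s hs, neg_zero]
    · by_cases hs : s = q
      · rw [hs, hrq r hr]
      · exact h3' r s (Ne.symm hr) (Ne.symm hs)

end Vanishing

/-! ### The degenerating family -/

section Degeneration

variable {R S : Type*} [CommRing R] [CommRing S]

/-- The parameters of the degenerating family: a `3 × 4` matrix and four scalars, which are the
parameter of the curve and the scaling factors of the three matrices. -/
abbrev Param : Type := (Fin 3 × Fin 4) ⊕ Fin 4

/-- The `2 × 2` minors of the rows `m`, `n` of the matrix part of `x`. -/
def paramMinor (x : Param → R) (m n : Fin 3) (a : Fin 6) : R :=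
  x (Sum.inl (m, pair a 0)) * x (Sum.inl (n, pair a 1)) -
    x (Sum.inl (m, pair a 1)) * x (Sum.inl (n, pair a 0))

/-- The signed `3 × 3` minors of the matrix part of `x`. -/
def paramPlane (x : Param → R) (i : Fin 4) : R :=
  (-1) ^ (i : ℕ) * (Matrix.of fun m n : Fin 3 => x (Sum.inl (m, i.succAbove n))).det

/-- The family of triples `(α X, β t⁻¹ ∧₂ X, γ t⁻³ ∧₃ X)` for `X = Aᵀ diag(1, t, t²) A`, written
without denominators, so that it makes sense for `t = 0`; there it is
`(α pᵀ p, β ℓᵀ ℓ, γ hᵀ h)` for the flag `(p, ℓ, h)` of the leading rows of `A`. -/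
def family (x : Param → R) : Var → R :=
  Sum.elim
    (Sym2.lift ⟨fun i j => x (Sum.inr 1) *
      (x (Sum.inl (0, i)) * x (Sum.inl (0, j)) +
        x (Sum.inr 0) * (x (Sum.inl (1, i)) * x (Sum.inl (1, j))) +
        x (Sum.inr 0) ^ 2 * (x (Sum.inl (2, i)) * x (Sum.inl (2, j)))),
      fun i j => by ring⟩)
    (Sum.elim
      (Sym2.lift ⟨fun a b => x (Sum.inr 2) *
        (paramMinor x 0 1 a * paramMinor x 0 1 b +
          x (Sum.inr 0) * (paramMinor x 0 2 a * paramMinor x 0 2 b) +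
          x (Sum.inr 0) ^ 2 * (paramMinor x 1 2 a * paramMinor x 1 2 b)),
        fun a b => by ring⟩)
      (Sym2.lift ⟨fun i j => x (Sum.inr 3) * (paramPlane x i * paramPlane x j),
        fun i j => by ring⟩))

theorem map_family (φ : R →+* S) (x : Param → R) (v : Var) :
    φ (family x v) = family (fun i => φ (x i)) v := by
  have hP : ∀ i, φ (paramPlane x i) = paramPlane (fun i => φ (x i)) i := fun i => by
    simp [paramPlane, det_fin_three]
  rcases v with v | v | v <;> induction v using Sym2.ind <;>
    simp [family, paramMinor, hP]

end Degeneration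

section Field

variable {F : Type*} [Field F]

/-- Away from the vanishing of the curve parameter, of the scaling factors, and of one entry of
each matrix, the family consists of representatives of points of the image of
`X ↦ (X, ∧₂ X, ∧₃ X)`. -/
theorem family_mem_multicone {x : Param → F} (ht : x (Sum.inr 0) ≠ 0)
    (h1 : family x (Sum.inl s(0, 0)) ≠ 0) (h2 : family x (Sum.inr (Sum.inl s(0, 0))) ≠ 0)
    (h3 : family x (Sum.inr (Sum.inr s(3, 3))) ≠ 0) :
    family x ∈ multicone (quadricImage F) := by
  set t := x (Sum.inr 0) with ht'
  set A : Matrix (Fin 3) (Fin 4) F := Matrix.of fun m i => x (Sum.inl (m, i)) with hA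
  have hX : (Aᵀ * Matrix.diagonal ![1, t, t ^ 2] * A).IsSymm := by
    rw [Matrix.IsSymm, transpose_mul, transpose_mul, diagonal_transpose, transpose_transpose,
      Matrix.mul_assoc]
  set X : SymMatrix 4 F := ⟨Aᵀ * Matrix.diagonal ![1, t, t ^ 2] * A, hX⟩ with hXdef
  have hXe : ∀ i j, X.1 i j = x (Sum.inl (0, i)) * x (Sum.inl (0, j)) +
        t * (x (Sum.inl (1, i)) * x (Sum.inl (1, j))) +
        t ^ 2 * (x (Sum.inl (2, i)) * x (Sum.inl (2, j))) := by
    intro i j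
    rw [hXdef]
    dsimp only
    rw [mul_apply, Fin.sum_univ_three]
    simp only [mul_diagonal, transpose_apply, hA, of_apply, cons_val]
    ring
  have hYe : ∀ a b, (wedge2 X).1 a b = t * (paramMinor x 0 1 a * paramMinor x 0 1 b +
          t * (paramMinor x 0 2 a * paramMinor x 0 2 b) +
          t ^ 2 * (paramMinor x 1 2 a * paramMinor x 1 2 b)) := by
    intro a b
    rw [wedge2_apply]
    simp only [hXe, paramMinor]
    ring
  have hZe : ∀ i j, (wedge3 X).1 i j = t ^ 3 * (paramPlane x i * paramPlane x j) := by
    intro i j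
    have h : X.1.submatrix i.succAbove j.succAbove =
        (Matrix.of fun m n : Fin 3 => x (Sum.inl (m, i.succAbove n)))ᵀ *
          Matrix.diagonal ![1, t, t ^ 2] *
          (Matrix.of fun m n : Fin 3 => x (Sum.inl (m, j.succAbove n))) := by
      ext a b
      rw [submatrix_apply, hXe, mul_apply, Fin.sum_univ_three]
      simp only [mul_diagonal, transpose_apply, of_apply, cons_val]
      ring
    rw [wedge3]
    simp only [of_apply]
    rw [h, det_mul, det_mul, det_transpose, det_diagonal, Fin.prod_univ_three]
    simp only [paramPlane, cons_val]
    ring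
  have hf : family x = coords (x (Sum.inr 1) • X) ((x (Sum.inr 2) * t⁻¹) • wedge2 X)
      ((x (Sum.inr 3) * (t ^ 3)⁻¹) • wedge3 X) := by
    funext v
    rcases v with v | v | v <;> induction v using Sym2.ind with | _ i j
    · change _ = x (Sum.inr 1) * X.1 i j
      rw [hXe]
      rfl
    · change _ = x (Sum.inr 2) * t⁻¹ * (wedge2 X).1 i j
      rw [hYe, mul_assoc, inv_mul_cancel_left₀ ht]
      rfl
    · change _ = x (Sum.inr 3) * (t ^ 3)⁻¹ * (wedge3 X).1 i j
      rw [hZe, mul_assoc, inv_mul_cancel_left₀ (pow_ne_zero 3 ht)]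
      rfl
  rw [hf] at h1 h2 h3 ⊢
  have n1 : x (Sum.inr 1) • X ≠ 0 := fun h => h1 (by rw [h]; rfl)
  have n2 : (x (Sum.inr 2) * t⁻¹) • wedge2 X ≠ 0 := fun h => h2 (by rw [h]; rfl)
  have n3 : (x (Sum.inr 3) * (t ^ 3)⁻¹) • wedge3 X ≠ 0 := fun h => h3 (by rw [h]; rfl)
  refine ⟨_, _, _, n1, n2, n3, ⟨X, right_ne_zero_of_smul n1, right_ne_zero_of_smul n2,
    right_ne_zero_of_smul n3, ?_⟩, rfl⟩
  simp only [Prod.mk.injEq, Projectivization.mk_eq_mk_iff']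
  exact ⟨⟨_, rfl⟩, ⟨_, rfl⟩, ⟨_, rfl⟩⟩

theorem aeval_bind₁_family {k L : Type*} [CommRing k] [CommRing L] [Algebra k L] (y : Param → L)
    (f : MvPolynomial Var k) :
    MvPolynomial.aeval y (MvPolynomial.bind₁ (family MvPolynomial.X) f) =
      MvPolynomial.aeval (family y) f := by
  rw [MvPolynomial.aeval_bind₁]
  congr 2
  funext v
  refine (map_family (MvPolynomial.aeval y : _ →ₐ[k] L).toRingHom _ v).trans ?_
  simp

variable {k K : Type*} [Field k] [Infinite k] [Field K] [Algebra k F] [Algebra k K]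

/-- A polynomial over an infinite field `k` that vanishes on the complete quadrics over one
extension of `k` vanishes on the whole degenerating family over every extension of `k`: its
pull-back to the parameters is the zero polynomial, as its product with a nonzero polynomial
vanishes at all `k`-points. -/
theorem aeval_family_eq_zero {f : MvPolynomial Var k} (hf : f ∈ idealOf k (quadricImage F))
    (y : Param → K) : MvPolynomial.aeval (family y) f = 0 := by
  set g : MvPolynomial Param k := MvPolynomial.bind₁ (family MvPolynomial.X) f with hg
  -- The conditions under which a point of the family represents a point of the image.
  set P : MvPolynomial Param k := MvPolynomial.X (Sum.inr 0) *
    (family MvPolynomial.X (Sum.inl s(0, 0)) * family MvPolynomial.X (Sum.inr (Sum.inl s(0, 0))) *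
      family MvPolynomial.X (Sum.inr (Sum.inr s(3, 3)))) with hP
  have hPe : ∀ x : Param → k, MvPolynomial.eval x P = x (Sum.inr 0) *
      (family x (Sum.inl s(0, 0)) * family x (Sum.inr (Sum.inl s(0, 0))) *
        family x (Sum.inr (Sum.inr s(3, 3)))) := by
    intro x
    simp only [hP, map_mul, map_family, MvPolynomial.eval_X]
  have hP0 : P ≠ 0 := by
    intro h
    -- The matrix `[1 | 0]` with all four scalars equal to one.
    have h1 := hPe (Sum.elim (fun mi => if mi.1.castSucc = mi.2 then 1 else 0) fun _ => 1)
    rw [h, map_zero] at h1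
    simp [family, paramMinor, paramPlane, det_fin_three, pair, Fin.succAbove] at h1
  have hgP : g * P = 0 := by
    refine MvPolynomial.funext fun x => ?_
    rw [map_mul, map_zero]
    by_cases hx : MvPolynomial.eval x P = 0
    · rw [hx, mul_zero]
    rw [hPe, ← ne_eq, mul_ne_zero_iff, mul_ne_zero_iff, mul_ne_zero_iff] at hx
    obtain ⟨h0, ⟨h1, h2⟩, h3⟩ := hx
    have hm : family (fun i => algebraMap k F (x i)) ∈ multicone (quadricImage F) := by
      apply family_mem_multicone
      · exact (map_ne_zero _).2 h0
      all_goals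
        rw [← map_family]
        exact (map_ne_zero _).2 ‹_›
    have h := MvPolynomial.mem_vanishingIdeal_iff.1 hf _ hm
    rw [← aeval_bind₁_family, ← hg] at h
    have h' : algebraMap k F (MvPolynomial.eval x g) = 0 := by
      rw [← h, ← MvPolynomial.coe_aeval_eq_eval]
      exact (MvPolynomial.aeval_algebraMap_apply F x g).symm
    rw [(map_eq_zero _).1 h', zero_mul]
  rw [← aeval_bind₁_family, ← hg, (mul_eq_zero.1 hgP).resolve_right hP0, map_zero]

end Field

/-! ### The two inclusions -/

section Field

variable {k F K : Type*} [Field k] [Field F] [Field K] [Algebra k F] [Algebra k K]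

/-- Passing to the Zariski closure over `F` does not change the ideal over a subfield. -/
theorem idealOf_zariskiClosure (S : Set (Ambient F)) :
    idealOf k (zariskiClosure S) = idealOf k S := by
  ext f
  simp only [idealOf, MvPolynomial.mem_vanishingIdeal_iff]
  constructor
  · rintro h c ⟨X, Y, Z, hX, hY, hZ, hS, rfl⟩
    refine h _ ⟨X, Y, Z, hX, hY, hZ, ?_, rfl⟩
    rintro _ ⟨X', Y', Z', hX', hY', hZ', hS', rfl⟩ g hg
    exact MvPolynomial.mem_vanishingIdeal_iff.1 hg _
      ⟨X', Y', Z', hX', hY', hZ', Set.mem_singleton_iff.1 hS' ▸ hS, rfl⟩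
  · rintro h c ⟨X, Y, Z, hX, hY, hZ, hS, rfl⟩
    have hf : MvPolynomial.map (algebraMap k F) f ∈ idealOf F S :=
      MvPolynomial.mem_vanishingIdeal_iff.2 fun c hc => by
        rw [MvPolynomial.aeval_map_algebraMap]
        exact h c hc
    have := hS (show _ ∈ multicone _ from ⟨X, Y, Z, hX, hY, hZ, rfl, rfl⟩) _ hf
    rwa [MvPolynomial.aeval_map_algebraMap] at this

/-- Each flag is the member at parameter `0` of the degenerating family. -/
theorem flagVariety_subset [Infinite k] :
    flagVariety K ⊆ veroneseTriple K ⁻¹' projZeroLocus K (idealOf k (quadricImage F)) := by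
  intro t ht
  obtain ⟨M, h1, h2, h3, rfl⟩ := exists_adapted_matrix ht
  rintro _ ⟨X, Y, Z, hX, hY, hZ, h, rfl⟩ f hf
  simp only [veroneseTriple, veronese, Projectivization.lift_mk, Set.mem_singleton_iff,
    Prod.mk.injEq, Projectivization.mk_eq_mk_iff'] at h
  obtain ⟨⟨α, rfl⟩, ⟨β, rfl⟩, ⟨γ, rfl⟩⟩ := h
  have hfam := aeval_family_eq_zero hf
    (Sum.elim (fun mi : Fin 3 × Fin 4 => M mi.1 mi.2) ![0, α, β, γ])
  convert hfam using 3
  funext v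
  rcases v with v | v | v <;> induction v using Sym2.ind with | _ i j
  · change α * (M 0 i * M 0 j) = _
    simp [family]
  · change β * (lineMinors _ i * lineMinors _ j) = _
    simp [family, paramMinor, lineMinors_eq]
  · rfl

theorem preimage_subset_flagVariety [CharZero K] :
    veroneseTriple K ⁻¹' projZeroLocus K (idealOf k (quadricImage F)) ⊆ flagVariety K := by
  rintro ⟨p, l, h⟩ H
  induction p using Projectivization.ind with | h p hp
  induction l using Projectivization.ind with | h l hl
  induction h using Projectivization.ind with | h h hh
  have key : ∀ f ∈ idealOf k (quadricImage F),
      MvPolynomial.aeval (coords (rankOne p) (rankOne l) (rankOne h)) f = 0 := fun f hf =>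
    H ⟨_, _, _, rankOne_ne_zero hp, rankOne_ne_zero hl, rankOne_ne_zero hh, rfl, rfl⟩ f hf
  set φ : MvPolynomial Var k →+* K :=
    (MvPolynomial.aeval (coords (rankOne p) (rankOne l) (rankOne h)) : _ →ₐ[k] K).toRingHom with hφ
  have hX : (fun v => φ (MvPolynomial.X v)) = coords (rankOne p) (rankOne l) (rankOne h) :=
    funext fun v => MvPolynomial.aeval_X _ v
  apply mem_flagVariety_of_relations hp hl hh
  · rw [← hX, ← map_pluckerRel]
    exact key _ pluckerRel_mem
  · intro r q s i j k'
    rw [← hX, ← map_pointLineRel]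
    exact key _ (pointLineRel_mem r q s i j k')
  · intro r s q i hr hs
    rw [← hX, ← map_linePlaneSum]
    exact key _ (linePlaneSum_mem hr hs i)
  · intro r s s' i hs hs'
    rw [← sub_eq_zero, ← hX, ← map_linePlaneSum, ← map_linePlaneSum, ← map_sub]
    exact key _ (linePlaneSum_sub_mem hs hs' i)

theorem flagVariety_eq_preimage [Infinite k] [CharZero K] :
    flagVariety K = veroneseTriple K ⁻¹' projZeroLocus K (idealOf k (quadricImage F)) :=
  flagVariety_subset.antisymm preimage_subset_flagVariety

end Field

end CompleteQuadrics

theorem corollary3p2 (K : Type*) [Field K] [CharZero K] :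
    CompleteQuadrics.flagVariety K =
        CompleteQuadrics.veroneseTriple K ⁻¹'
          CompleteQuadrics.projZeroLocus K CompleteQuadrics.idealI4 ∧
      CompleteQuadrics.flagVariety K =
        CompleteQuadrics.veroneseTriple K ⁻¹' CompleteQuadrics.completeQuadrics K := by
  have : Infinite K := Infinite.of_injective _ (Nat.cast_injective (R := K))
  constructor
  · rw [CompleteQuadrics.idealI4, CompleteQuadrics.completeQuadrics,
      CompleteQuadrics.idealOf_zariskiClosure]
    exact CompleteQuadrics.flagVariety_eq_preimage
  · exact CompleteQuadrics.flagVariety_eq_preimage (k := K) (F := K)
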